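/- \textbf{Definitions.} For pseudo-metric spaces $(Z_n,d_n)_{n\in\mathbb N}$ and $p\ge 1$, let $E((Z_n)_{n};p)$ be the equivalence relation on $\prod_n Z_n$ given by $x\mathrel{E}y\iff\sum_{n}d_n(x(n),y(n))^p<\infty$. For $z\in\prod_n Z_n$ let $\ell_p((Z_n)_n,z)=\{y\in\prod_n Z_n:\sum_n d_n(y(n),z(n))^p<\infty\}$ with the pseudo-metric $\left(\sum_n d_n(x(n),y(n))^p\right)^{1/p}$. For equivalence relations $E,F$ on $P,Q$, write $E\le_B F$ if there is a Borel map $\theta:P\to Q$ with $x\mathrel{E}y\iff\theta(x)\mathrel{F}\theta(y)$ for all $x,y\in P$. For a nonempty separable complete metric space $X$, $F(X;p)$ denotes $E((F_n)_n;p)$, where $F_0\subseteq F_1\subseteq\cdots$ are nonempty finite subsets of $X$ with dense union (the choice of such a sequence is arbitrary; up to Borel bireducibility the relation does not depend on it). For $C>0$, a metric space $(X,d)$ satisfies $\mathrm{link}(C)$ if for every $\varepsilon>0$ there is $N\ge1$ such that for all $u,v\in X$ with $d(u,v)<C$ there are $r_0,\dots,r_N\in X$ with $r_0=u$, $r_N=v$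 and $d(r_{i-1},r_i)<\varepsilon$ for $1\le i\le N$. For $C,\alpha>0$, $(X,d)$ can $C$-finitely Hölder$(\alpha)$ embed into a pseudo-metric space $(X',d')$ if there are $A,D>0$ such that for every finite $F\subseteq X$ there is $T_F:F\to X'$ such that for all $u,v\in F$: if $d(u,v)\ge C$ then $d'(T_F(u),T_F(v))\ge D$; and if $d(u,v)<C$ then $A^{-1}d(u,v)^\alpha\le d'(T_F(u),T_F(v))\le A\,d(u,v)^\alpha$. \textbf{Theorem.} Let $(X,d)$ and $(Y,\delta)$ be nonempty separable complete metric spaces, $p,q\in[1,\infty)$, and let $Y_0\subseteq Y_1\subseteq Y_2\subseteq\cdots$ be nonempty Borel subsets of $Y$ with $\bigcup_{n}Y_n$ dense in $Y$. Let $C>0$ and suppose that $X$ satisfies $\mathrm{link}(C)$. Then, for any choice of the sequences of finite sets defining $F(X;p)$ and $F(Y;q)$, the following conditions are equivalent: (a) $X$ can $C$-finitely Hölder$(p/q)$ embed into $\ell_q((Y_n)_{n},y^*)$ for some $y^*\in\prod_{n}Y_n$; (b) $F(X;p)\le_B E((Y_n)_{n};q)$; (c) $F(X;p)\le_B F(Y;q)$.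 -/

import Mathlib

theorem summable_dist_rpow_triangle {Z : ℕ → Type*} [∀ n, PseudoMetricSpace (Z n)] {p : ℝ}
    (hp : 1 ≤ p) {x y z : ∀ n, Z n} (hxy : Summable fun n => dist (x n) (y n) ^ p)
    (hyz : Summable fun n => dist (y n) (z n) ^ p) :
    (Summable fun n => dist (x n) (z n) ^ p) ∧
      (∑' n, dist (x n) (z n) ^ p) ^ (1 / p) ≤
        (∑' n, dist (x n) (y n) ^ p) ^ (1 / p) + (∑' n, dist (y n) (z n) ^ p) ^ (1 / p) := by
  have hp0 : 0 ≤ p := zero_le_one.trans hp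
  obtain ⟨hs, hle⟩ := Real.Lp_add_le_tsum_of_nonneg hp (f := fun n => dist (x n) (y n))
    (g := fun n => dist (y n) (z n)) (fun _ => dist_nonneg) (fun _ => dist_nonneg) hxy hyz
  have hterm : ∀ n, dist (x n) (z n) ^ p ≤ (dist (x n) (y n) + dist (y n) (z n)) ^ p := fun n =>
    Real.rpow_le_rpow dist_nonneg (dist_triangle _ _ _) hp0
  have hxz : Summable fun n => dist (x n) (z n) ^ p :=
    Summable.of_nonneg_of_le (fun n => Real.rpow_nonneg dist_nonneg p) hterm hs
  refine ⟨hxz, le_trans ?_ hle⟩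
  exact Real.rpow_le_rpow (tsum_nonneg fun n => Real.rpow_nonneg dist_nonneg p)
    (hxz.tsum_le_tsum hterm hs) (by positivity)

/-- The `ℓ_p`-like equivalence relation `E((Z_n); p)` on `∏ Z_n`:
`x` and `y` are equivalent iff `∑ d_n(x(n), y(n))^p < ∞`. -/
def ellRel (Z : ℕ → Type*) [∀ n, PseudoMetricSpace (Z n)] {p : ℝ} (hp : 1 ≤ p) :
    Setoid (∀ n, Z n) where
  r x y := Summable fun n => dist (x n) (y n) ^ p
  iseqv :=
    { refl := fun x => by
        have hp0 : p ≠ 0 := by linarith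
        simp [Real.zero_rpow hp0, summable_zero]
      symm := fun {x y} h => by simpa only [dist_comm] using h
      trans := fun h₁ h₂ => (summable_dist_rpow_triangle hp h₁ h₂).1 }

/-- The space `ℓ_q((Z_n), z)`: the sequences at finite `ℓ_q`-distance from the base point `z`. -/
def EllSpace (Z : ℕ → Type*) [∀ n, PseudoMetricSpace (Z n)] (z : ∀ n, Z n) {q : ℝ}
    (_hq : 1 ≤ q) : Type _ :=
  {y : ∀ n, Z n // Summable fun n => dist (y n) (z n) ^ q}

/-- The pseudo-metric `δ_q(x, y) = (∑ δ_n(x(n), y(n))^q)^(1/q)` on `ℓ_q((Z_n), z)`. -/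
noncomputable instance EllSpace.instPseudoMetricSpace (Z : ℕ → Type*)
    [∀ n, PseudoMetricSpace (Z n)] (z : ∀ n, Z n) {q : ℝ} (hq : 1 ≤ q) :
    PseudoMetricSpace (EllSpace Z z hq) where
  dist x y := (∑' n, dist (x.1 n) (y.1 n) ^ q) ^ (1 / q)
  dist_self x := by
    have hq0 : q ≠ 0 := by linarith
    simp [Real.zero_rpow hq0, hq0]
  dist_comm x y := by simp only [dist_comm]
  dist_triangle x y w := by
    have key : ∀ a b : EllSpace Z z hq, Summable fun n => dist (a.1 n) (b.1 n) ^ q := fun a b =>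
      (summable_dist_rpow_triangle hq a.2 (by simpa only [dist_comm] using b.2)).1
    exact (summable_dist_rpow_triangle hq (key x y) (key y w)).2

/-- `E ≤_B F`: there is a Borel map `θ` with `x E y ↔ θ(x) F θ(y)`. -/
def BorelReducible {α β : Type*} [MeasurableSpace α] [MeasurableSpace β]
    (E : Setoid α) (F : Setoid β) : Prop :=
  ∃ θ : α → β, Measurable θ ∧ ∀ x y, E x y ↔ F (θ x) (θ y)

/-- An increasing sequence of nonempty finite subsets of `X` with dense union. For such a sequence
`F(X; p)` denotes the relation `E((F_n); p)`. -/
structure IsFiniteExhaustion {X : Type*} [TopologicalSpace X] (F : ℕ → Set X) : Prop where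
  finite : ∀ n, (F n).Finite
  nonempty : ∀ n, (F n).Nonempty
  mono : Monotone F
  dense : Dense (⋃ n, F n)

/-- The condition `link(C)`. -/
def Link (X : Type*) [PseudoMetricSpace X] (C : ℝ) : Prop :=
  ∀ ε : ℝ, 0 < ε → ∃ N : ℕ, 1 ≤ N ∧ ∀ u v : X, dist u v < C →
    ∃ r : ℕ → X, r 0 = u ∧ r N = v ∧ ∀ i < N, dist (r i) (r (i + 1)) < ε

/-- `X` can `C`-finitely Hölder(`α`) embed into `X'`. -/
def FinitelyHolderEmbeds (X X' : Type*) [PseudoMetricSpace X] [PseudoMetricSpace X']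
    (C α : ℝ) : Prop :=
  ∃ A D : ℝ, 0 < A ∧ 0 < D ∧ ∀ F : Finset X, ∃ T : F → X', ∀ u v : F,
    (C ≤ dist u v → D ≤ dist (T u) (T v)) ∧
    (dist u v < C →
      A⁻¹ * dist u v ^ α ≤ dist (T u) (T v) ∧ dist (T u) (T v) ≤ A * dist u v ^ α)

/-!
A Borel map on a product of finite sets is continuous on a dense `G_δ` set, and along a generic
point the tails of its values stop depending on any given initial segment of the argument. Fusing
these two facts gives a subproduct on which a reduction of `F(X; p)` is, up to a summable error, a
concatenation of maps `S_j` of single coordinates. Repeating a pair of points at distance `d` about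
`d⁻ᵖ` times turns the equivalence of the two summability conditions into a lower Hölder bound for
`S_j`, and an upper one once the `S_j` are known to be bounded on pairs at distance less than `C`;
that bound is what `link(C)` provides. Conversely, Hölder embeddings of the `F_n` into `ℓ_q`,
applied coordinate by coordinate, form a reduction after merging the double sequence into one.
The choice of the dense union in `Y` does not matter, because finite subsets of one `ℓ_q` space
are reproduced in the other one with arbitrarily small relative error.
-/

open Filter Function Topology

namespace EllSpace

section

variable {Z : ℕ → Type*} [∀ n, PseudoMetricSpace (Z n)] {z : ∀ n, Z n} {q : ℝ} {hq : 1 ≤ q}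

theorem summable_dist_rpow (x y : EllSpace Z z hq) :
    Summable fun n => dist (x.1 n) (y.1 n) ^ q :=
  (summable_dist_rpow_triangle hq x.2 (by simpa only [dist_comm] using y.2)).1

theorem dist_rpow (x y : EllSpace Z z hq) :
    dist x y ^ q = ∑' n, dist (x.1 n) (y.1 n) ^ q := by
  change ((∑' n, dist (x.1 n) (y.1 n) ^ q) ^ (1 / q)) ^ q = _
  rw [one_div, Real.rpow_inv_rpow (tsum_nonneg fun n => by positivity) (by linarith)]

variable (z hq) in
/-- The point of `ℓ_q((Z_n), z)` that agrees with `w` on the finite set `s` and with the base point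
elsewhere. -/
noncomputable def modify (s : Finset ℕ) (w : ∀ n, Z n) : EllSpace Z z hq :=
  ⟨s.piecewise w z, summable_of_ne_finset_zero (s := s) fun n hn => by
    simp [hn, Real.zero_rpow (by linarith : q ≠ 0)]⟩

theorem dist_modify_rpow (s : Finset ℕ) (w w' : ∀ n, Z n) :
    dist (modify z hq s w) (modify z hq s w') ^ q = ∑ n ∈ s, dist (w n) (w' n) ^ q := by
  rw [dist_rpow, tsum_eq_sum (s := s) fun n hn => ?_]
  · exact Finset.sum_congr rfl fun n hn => by simp [modify, hn]
  · simp [modify, hn, Real.zero_rpow (by linarith : q ≠ 0)]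

theorem dist_modify (s : Finset ℕ) (w w' : ∀ n, Z n) :
    dist (modify z hq s w) (modify z hq s w') = (∑ n ∈ s, dist (w n) (w' n) ^ q) ^ (1 / q) := by
  rw [← dist_modify_rpow, one_div, Real.rpow_rpow_inv dist_nonneg (by linarith)]

end

end EllSpace

/-- The two conditions on a pair of distances `s = d(u, v)` and `t = d'(T u, T v)` in the
definition of a `C`-finite Hölder(`α`) embedding with constants `A` and `D`. -/
def HolderComparable (C α A D s t : ℝ) : Prop :=
  (C ≤ s → D ≤ t) ∧ (s < C → A⁻¹ * s ^ α ≤ t ∧ t ≤ A * s ^ α)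

namespace HolderComparable

variable {C α A D s s' t t' : ℝ}

theorem pos (h : HolderComparable C α A D s t) (hA : 0 < A) (hD : 0 < D) (hs : 0 < s) :
    0 < t := by
  rcases le_or_gt C s with hCs | hsC
  · exact hD.trans_le (h.1 hCs)
  · exact lt_of_lt_of_le (by positivity) (h.2 hsC).1

theorem of_target (h : HolderComparable C α A D s t) (h₁ : t / 2 ≤ t') (h₂ : t' ≤ 2 * t) :
    HolderComparable C α (2 * A) (D / 2) s t' := by
  refine ⟨fun hs => by linarith [h.1 hs], fun hs => ?_⟩
  obtain ⟨h₃, h₄⟩ := h.2 hs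
  rw [mul_inv]
  constructor <;> linarith

theorem of_source (h : HolderComparable C α A D s' t) (hC : 0 < C) (hα : 0 ≤ α) (hA : 0 < A)
    (hs : 0 ≤ s) (h₁ : s / 2 ≤ s') (h₂ : s' ≤ 2 * s) (h₃ : s < C → s' < C) :
    HolderComparable C α (2 ^ α * A) (min D (A⁻¹ * (C / 2) ^ α)) s t := by
  have hs' : 0 ≤ s' := by linarith
  constructor
  · intro hCs
    rcases le_or_gt C s' with hC' | hC'
    · exact (min_le_left _ _).trans (h.1 hC')
    · calc min D (A⁻¹ * (C / 2) ^ α) ≤ A⁻¹ * (C / 2) ^ α := min_le_right _ _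
        _ ≤ A⁻¹ * s' ^ α := by gcongr; linarith
        _ ≤ t := (h.2 hC').1
  · intro hsC
    obtain ⟨h₄, h₅⟩ := h.2 (h₃ hsC)
    constructor
    · calc (2 ^ α * A)⁻¹ * s ^ α = A⁻¹ * (s / 2) ^ α := by
            rw [Real.div_rpow hs zero_le_two]; field_simp
        _ ≤ A⁻¹ * s' ^ α := by gcongr
        _ ≤ t := h₄
    · calc t ≤ A * s' ^ α := h₅
        _ ≤ A * (2 * s) ^ α := by gcongr
        _ = 2 ^ α * A * s ^ α := by rw [Real.mul_rpow zero_le_two hs]; ring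

end HolderComparable

theorem eventually_lt_of_summable_rpow {ι : Type*} {f : ι → ℝ} {r ε : ℝ} (hr : 0 < r)
    (hf : ∀ i, 0 ≤ f i) (hs : Summable fun i => f i ^ r) (hε : 0 < ε) :
    ∀ᶠ i in cofinite, f i < ε := by
  filter_upwards [hs.tendsto_cofinite_zero.eventually (gt_mem_nhds (Real.rpow_pos_of_pos hε r))]
    with i hi
  exact (Real.rpow_lt_rpow_iff (hf i) hε.le hr).1 hi

theorem summable_rpow_iff_of_holderComparable {ι : Type*} {p q C A D : ℝ} (hp : 0 < p)
    (hq : 0 < q) (hC : 0 < C) (hA : 0 < A) (hD : 0 < D) {s t : ι → ℝ} (hs : ∀ i, 0 ≤ s i)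
    (ht : ∀ i, 0 ≤ t i) (h : ∀ i, HolderComparable C (p / q) A D (s i) (t i)) :
    (Summable fun i => s i ^ p) ↔ Summable fun i => t i ^ q := by
  have hpow : ∀ i, (s i ^ (p / q)) ^ q = s i ^ p := fun i => by
    rw [← Real.rpow_mul (hs i), div_mul_cancel₀ _ hq.ne']
  constructor
  · intro hsum
    refine (hsum.mul_left (A ^ q)).of_norm_bounded_eventually ?_
    filter_upwards [eventually_lt_of_summable_rpow hp hs hsum hC] with i hi
    rw [Real.norm_of_nonneg (Real.rpow_nonneg (ht i) q), ← hpow,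
      ← Real.mul_rpow hA.le (Real.rpow_nonneg (hs i) _)]
    exact Real.rpow_le_rpow (ht i) ((h i).2 hi).2 hq.le
  · intro hsum
    refine (hsum.mul_left (A ^ q)).of_norm_bounded_eventually ?_
    filter_upwards [eventually_lt_of_summable_rpow hq ht hsum hD] with i hi
    have hsC : s i < C := lt_of_not_ge fun hCs => ((h i).1 hCs).not_gt hi
    rw [Real.norm_of_nonneg (Real.rpow_nonneg (hs i) p), ← hpow, ← Real.mul_rpow hA.le (ht i)]
    exact Real.rpow_le_rpow (Real.rpow_nonneg (hs i) _)
      ((inv_mul_le_iff₀ hA).1 ((h i).2 hsC).1) hq.le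

/-! ### Finite representability -/

/-- Every finite part of `E` can be copied into `E'` with all mutual distances changed by as little
as one likes. Only the distance matrix of the copy is recorded, so this is a closure condition in
the space of matrices. -/
def FinitelyRepresentable (E E' : Type*) [PseudoMetricSpace E] [PseudoMetricSpace E'] : Prop :=
  ∀ F : Finset E, (fun u v : F => dist u v) ∈
    closure (Set.range fun (T : F → E') (u v : F) => dist (T u) (T v))

theorem FinitelyRepresentable.exists_map {E E' : Type*} [PseudoMetricSpace E]
    [PseudoMetricSpace E'] (h : FinitelyRepresentable E E') (F : Finset E) (C : ℝ) :
    ∃ T : F → E', ∀ u v : F,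
      (0 < dist u v → dist u v / 2 ≤ dist (T u) (T v) ∧ dist (T u) (T v) ≤ 2 * dist u v) ∧
      (dist u v < C → dist (T u) (T v) < C) := by
  have hlim : ∀ u v, Tendsto (fun m : F → F → ℝ => m u v) (𝓝 fun u v : F => dist u v)
      (𝓝 (dist u v)) := fun u v => (continuous_apply_apply u v).tendsto _
  have hev : ∀ᶠ m in 𝓝 fun u v : F => dist u v, ∀ u v,
      (0 < dist u v → dist u v / 2 ≤ m u v ∧ m u v ≤ 2 * dist u v) ∧
      (dist u v < C → m u v < C) := by
    refine eventually_all.2 fun u => eventually_all.2 fun v =>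
      .and (eventually_imp_distrib_left.2 fun huv => ?_)
        (eventually_imp_distrib_left.2 fun huv => (hlim u v).eventually (gt_mem_nhds huv))
    filter_upwards [(hlim u v).eventually (Ioo_mem_nhds (half_lt_self huv)
      (by linarith : dist u v < 2 * dist u v))] with m hm using ⟨hm.1.le, hm.2.le⟩
  obtain ⟨_, ⟨T, rfl⟩, hT⟩ := (mem_closure_iff_frequently.1 (h F)).and_eventually hev |>.exists
  exact ⟨T, hT⟩

theorem finitelyRepresentable_of_dense {E : Type*} [PseudoMetricSpace E] {s : Set E}
    (hs : Dense s) : FinitelyRepresentable E s := fun F => by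
  have hcont : Continuous fun (y : F → E) u v => dist (y u) (y v) := by fun_prop
  refine map_mem_closure (f := fun (y : F → E) u v => dist (y u) (y v)) hcont
    (dense_pi (s := fun _ : F => s) Set.univ (fun _ _ => hs) fun u => u.1) fun y hy => ?_
  exact ⟨fun u => ⟨y u, hy u (Set.mem_univ u)⟩, rfl⟩

namespace EllSpace

variable {Y : Type*} [PseudoMetricSpace Y] {q : ℝ} {Z : ℕ → Set Y}

theorem exists_dist_eq_sum_range (z : ∀ n, Z n) (hq : 1 ≤ q) (hZ : Monotone Z) {ι : Type*}
    [Finite ι] {m : ℕ} {y : ι → ℕ → Y} (hy : ∀ u i, y u i ∈ ⋃ n, Z n) :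
    ∃ T : ι → EllSpace (fun n => Z n) z hq, ∀ u v,
      dist (T u) (T v) = (∑ i ∈ Finset.range m, dist (y u i) (y v i) ^ q) ^ (1 / q) := by
  have hK : ∀ᶠ K in atTop, ∀ u, ∀ i : Fin m, y u i ∈ Z K := by
    refine eventually_all.2 fun u => eventually_all.2 fun i => ?_
    obtain ⟨K, hK⟩ := Set.mem_iUnion.1 (hy u i)
    exact eventually_atTop.2 ⟨K, fun L hL => hZ hL hK⟩
  obtain ⟨K, hK⟩ := hK.exists
  have hmem : ∀ u n, ∃ b : Z n, n - K < m → K ≤ n → b.1 = y u (n - K) := fun u n => by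
    by_cases hn : n - K < m ∧ K ≤ n
    · exact ⟨⟨_, hZ hn.2 (hK u ⟨_, hn.1⟩)⟩, fun _ _ => rfl⟩
    · exact ⟨z n, fun h₁ h₂ => (hn ⟨h₁, h₂⟩).elim⟩
  choose b hb using hmem
  refine ⟨fun u => modify z hq (Finset.Ico K (K + m)) (b u), fun u v => ?_⟩
  rw [dist_modify, Finset.sum_Ico_eq_sum_range, Nat.add_sub_cancel_left]
  congr 1
  refine Finset.sum_congr rfl fun i hi => ?_
  have hbi : ∀ u, (b u (K + i)).1 = y u i := fun u => by
    rw [hb u _ (by simpa using hi) (Nat.le_add_right K i), Nat.add_sub_cancel_left]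
  rw [Subtype.dist_eq, hbi u, hbi v]

theorem finitelyRepresentable {W : ℕ → Set Y} (w : ∀ n, W n) (z : ∀ n, Z n) (hq : 1 ≤ q)
    (hZ : Monotone Z) (hZd : Dense (⋃ n, Z n)) :
    FinitelyRepresentable (EllSpace (fun n => W n) w hq) (EllSpace (fun n => Z n) z hq) := by
  intro F
  have hq₀ : 0 < q := by linarith
  let truncatedDist (m : ℕ) (y : F → ℕ → Y) (u v : F) : ℝ :=
    (∑ i ∈ Finset.range m, dist (y u i) (y v i) ^ q) ^ (1 / q)
  have hcont : ∀ m, Continuous (truncatedDist m) := fun m => by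
    refine continuous_pi fun u => continuous_pi fun v => ?_
    refine Continuous.rpow_const (continuous_finsetSum _ fun i _ => ?_)
      fun _ => Or.inr (by positivity)
    exact Continuous.rpow_const (by fun_prop) fun _ => Or.inr hq₀.le
  have hlim : Tendsto (fun m => truncatedDist m fun u i => (u.1.1 i).1) atTop
      (𝓝 fun u v : F => dist u v) := by
    refine tendsto_pi_nhds.2 fun u => tendsto_pi_nhds.2 fun v => ?_
    exact (summable_dist_rpow u.1 v.1).hasSum.tendsto_sum_nat.rpow_const
      (Or.inr (by positivity))
  refine isClosed_closure.mem_of_tendsto hlim (.of_forall fun m => ?_)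
  refine map_mem_closure (hcont m) (dense_pi (s := fun _ : F => {y : ℕ → Y | ∀ i, y i ∈ ⋃ n, Z n})
    Set.univ (fun u _ => ?_) _) fun y hy => ?_
  · simpa [Set.pi] using dense_pi (s := fun _ : ℕ => ⋃ n, Z n) Set.univ fun _ _ => hZd
  · obtain ⟨T, hT⟩ := exists_dist_eq_sum_range z hq hZ (m := m) fun u => hy u (Set.mem_univ u)
    exact ⟨T, funext fun u => funext fun v => hT u v⟩

end EllSpace

namespace FinitelyHolderEmbeds

variable {C α : ℝ}

theorem of_finitelyRepresentable_target {X E E' : Type*} [MetricSpace X] [PseudoMetricSpace E]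
    [PseudoMetricSpace E'] (hE : FinitelyRepresentable E E') (hC : 0 < C) (hα : 0 < α)
    (h : FinitelyHolderEmbeds X E C α) : FinitelyHolderEmbeds X E' C α := by
  classical
  obtain ⟨A, D, hA, hD, h⟩ := h
  refine ⟨2 * A, D / 2, by positivity, by positivity, fun F => ?_⟩
  obtain ⟨T, hT⟩ := h F
  obtain ⟨R, hR⟩ := hE.exists_map (Finset.univ.image T) C
  have hTmem : ∀ u, T u ∈ Finset.univ.image T := fun u =>
    Finset.mem_image_of_mem T (Finset.mem_univ u)
  refine ⟨fun u => R ⟨T u, hTmem u⟩, fun u v => ?_⟩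
  have hcomp : HolderComparable C α A D (dist u v) (dist (T u) (T v)) := hT u v
  rcases eq_or_ne u v with rfl | huv
  · simp [hC.not_ge, Real.zero_rpow hα.ne']
  · obtain ⟨h₁, h₂⟩ := (hR ⟨T u, hTmem u⟩ ⟨T v, hTmem v⟩).1 (hcomp.pos hA hD (dist_pos.2 huv))
    exact hcomp.of_target h₁ h₂

theorem of_finitelyRepresentable_source {X X' E : Type*} [MetricSpace X] [PseudoMetricSpace X']
    [PseudoMetricSpace E] (hX : FinitelyRepresentable X X') (hC : 0 < C) (hα : 0 < α)
    (h : FinitelyHolderEmbeds X' E C α) : FinitelyHolderEmbeds X E C α := by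
  classical
  obtain ⟨A, D, hA, hD, h⟩ := h
  refine ⟨2 ^ α * A, min D (A⁻¹ * (C / 2) ^ α), by positivity, by positivity, fun F => ?_⟩
  obtain ⟨R, hR⟩ := hX.exists_map F C
  obtain ⟨T, hT⟩ := h (Finset.univ.image R)
  have hRmem : ∀ u, R u ∈ Finset.univ.image R := fun u =>
    Finset.mem_image_of_mem R (Finset.mem_univ u)
  refine ⟨fun u => T ⟨R u, hRmem u⟩, fun u v => ?_⟩
  rcases eq_or_ne u v with rfl | huv
  · simp [hC.not_ge, Real.zero_rpow hα.ne']
  · have hcomp : HolderComparable C α A D (dist (R u) (R v)) _ := hT ⟨R u, hRmem u⟩ ⟨R v, hRmem v⟩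
    obtain ⟨h₁, h₂⟩ := (hR u v).1 (dist_pos.2 huv)
    exact hcomp.of_source hC hα.le hA dist_nonneg h₁ h₂ (hR u v).2

end FinitelyHolderEmbeds

/-! ### Coordinatewise reductions -/

/-- The maps `S_j : K_j → E`, applied coordinate by coordinate, turn finiteness of
`∑ d(x_j, y_j)^p` into finiteness of `∑ d(S_j(x_j), S_j(y_j))^q` and conversely. -/
def ReducesCoordinatewise {K : ℕ → Type*} {E : Type*} [∀ j, PseudoMetricSpace (K j)]
    [PseudoMetricSpace E] (S : ∀ j, K j → E) (p q : ℝ) : Prop :=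
  ∀ x y : ∀ j, K j, (Summable fun j => dist (x j) (y j) ^ p) ↔
    Summable fun j => dist (S j (x j)) (S j (y j)) ^ q

theorem FinitelyHolderEmbeds.exists_reducesCoordinatewise {X E : Type*} [PseudoMetricSpace X]
    [PseudoMetricSpace E] {p q C : ℝ} (hp : 0 < p) (hq : 0 < q) (hC : 0 < C)
    (h : FinitelyHolderEmbeds X E C (p / q)) {F : ℕ → Set X} (hF : ∀ n, (F n).Finite) :
    ∃ S : ∀ j, F j → E, ReducesCoordinatewise S p q := by
  obtain ⟨A, D, hA, hD, h⟩ := h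
  choose T hT using fun j => h (hF j).toFinset
  refine ⟨fun j u => T j ⟨u, (hF j).mem_toFinset.2 u.2⟩, fun x y => ?_⟩
  exact summable_rpow_iff_of_holderComparable hp hq hC hA hD (fun _ => dist_nonneg)
    (fun _ => dist_nonneg) fun j => hT j ⟨x j, _⟩ ⟨y j, _⟩

theorem exists_extension_of_injective {ι κ : Type*} {K : κ → Type*} {φ : ι → κ}
    (hφ : Injective φ) (x : ∀ i, K (φ i)) (a : ∀ j, K j) :
    ∃ x' : ∀ j, K j, (∀ i, x' (φ i) = x i) ∧ ∀ j ∉ Set.range φ, x' j = a j := by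
  have hval : ∀ j, ∃ b : K j, (∀ i, φ i = j → HEq b (x i)) ∧ (j ∉ Set.range φ → b = a j) := by
    intro j
    by_cases hj : j ∈ Set.range φ
    · obtain ⟨i, rfl⟩ := hj
      exact ⟨x i, fun i' hi' => by rw [hφ hi'], fun h => (h ⟨i, rfl⟩).elim⟩
    · exact ⟨a j, fun i hi => (hj ⟨i, hi⟩).elim, fun _ => rfl⟩
  choose x' hx' ha using hval
  exact ⟨x', fun i => eq_of_heq (hx' _ i rfl), ha⟩

namespace ReducesCoordinatewise

variable {K : ℕ → Type*} [∀ j, PseudoMetricSpace (K j)] {p q : ℝ}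

theorem summable_iff_of_injective {E : Type*} [PseudoMetricSpace E] [∀ j, Nonempty (K j)]
    {S : ∀ j, K j → E} (h : ReducesCoordinatewise S p q) (hp : 0 < p) (hq : 0 < q) {ι : Type*}
    {φ : ι → ℕ} (hφ : Injective φ) (x y : ∀ i, K (φ i)) :
    (Summable fun i => dist (x i) (y i) ^ p) ↔
      Summable fun i => dist (S (φ i) (x i)) (S (φ i) (y i)) ^ q := by
  let a : ∀ j, K j := fun j => Classical.arbitrary _
  obtain ⟨x', hx', hxa⟩ := exists_extension_of_injective hφ x a
  obtain ⟨y', hy', hya⟩ := exists_extension_of_injective hφ y a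
  have key := h x' y'
  rw [← hφ.summable_iff, ← hφ.summable_iff] at key
  · simpa only [comp_def, hx', hy'] using key
  all_goals
    intro j hj
    simp [hxa j hj, hya j hj, Real.zero_rpow, hp.ne', hq.ne']

theorem borelReducible {Y : Type*} [PseudoMetricSpace Y] [MeasurableSpace Y] {Z : ℕ → Set Y}
    {z : ∀ n, Z n} [∀ j, Finite (K j)] [∀ j, MeasurableSpace (K j)]
    [∀ j, MeasurableSingletonClass (K j)] {hq : 1 ≤ q}
    {S : ∀ j, K j → EllSpace (fun n => Z n) z hq} (h : ReducesCoordinatewise S p q)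
    (hp : 1 ≤ p) (hZ : Monotone Z) :
    BorelReducible (ellRel K hp) (ellRel (fun n => Z n) hq) := by
  let component (k : ℕ) (u : K k.unpair.1) : Z k :=
    ⟨(S k.unpair.1 u).1 k.unpair.2, hZ (Nat.unpair_right_le k) (Subtype.prop _)⟩
  refine ⟨fun x k => component k (x k.unpair.1), measurable_pi_lambda _ fun k =>
    (measurable_of_finite (component k)).comp (measurable_pi_apply _), fun x y => ?_⟩
  have hreindex : (fun k => dist (component k (x k.unpair.1)) (component k (y k.unpair.1)) ^ q) =
      (fun a : ℕ × ℕ => dist ((S a.1 (x a.1)).1 a.2) ((S a.1 (y a.1)).1 a.2) ^ q) ∘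
        Nat.pairEquiv.symm := rfl
  have hsections : ∀ j, Summable fun i => dist ((S j (x j)).1 i) ((S j (y j)).1 i) ^ q :=
    fun j => (S j (x j)).summable_dist_rpow (S j (y j))
  calc (Summable fun j => dist (x j) (y j) ^ p)
      ↔ Summable fun j => dist (S j (x j)) (S j (y j)) ^ q := h x y
    _ ↔ Summable fun a : ℕ × ℕ => dist ((S a.1 (x a.1)).1 a.2) ((S a.1 (y a.1)).1 a.2) ^ q := by
        rw [summable_prod_of_nonneg fun a => by positivity]
        simp only [EllSpace.dist_rpow]
        exact (and_iff_right hsections).symm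
    _ ↔ Summable fun k =>
          dist (component k (x k.unpair.1)) (component k (y k.unpair.1)) ^ q := by
        rw [hreindex, Equiv.summable_iff]

end ReducesCoordinatewise

theorem exists_injective_of_frequently {ι : Type*} [Countable ι] {P : ι → ℕ → Prop}
    (h : ∀ i, ∃ᶠ j in atTop, P i j) : ∃ φ : ι → ℕ, Injective φ ∧ ∀ i, P i (φ i) := by
  obtain ⟨e, he⟩ := exists_injective_nat ι
  have h' : ∀ n, ∃ᶠ j in atTop, ∀ i, e i = n → P i j := fun n => by
    by_cases hn : ∃ i, e i = n
    · obtain ⟨i, rfl⟩ := hn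
      exact (h i).mono fun j hj i' hi' => he hi' ▸ hj
    · exact Frequently.of_forall fun j i hi => (hn ⟨i, hi⟩).elim
  obtain ⟨φ, hφ, hP⟩ := extraction_forall_of_frequently h'
  exact ⟨fun i => φ (e i), hφ.injective.comp he, fun i => hP _ i rfl⟩

theorem summable_sigma_fin_iff {M : ℕ → ℕ} {f : ℕ → ℝ} (hf : ∀ k, 0 ≤ f k) :
    (Summable fun i : Σ k, Fin (M k) => f i.1) ↔ Summable fun k => M k * f k := by
  rw [summable_sigma_of_nonneg fun i => hf i.1]
  simp [tsum_fintype, Summable.of_finite]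

/-- Summability of `f` implies summability of `g` along every choice of points `w_i ∈ B_{φ(i)}`
placed at pairwise distinct coordinates `φ(i)`. -/
def SummabilityTransfers {P : Type*} (B : ℕ → Set P) (f g : ℕ → P → ℝ) : Prop :=
  ∀ ⦃ι : Type⦄ (φ : ι → ℕ), Injective φ → ∀ w : ι → P, (∀ i, w i ∈ B (φ i)) →
    Summable (fun i => f (φ i) (w i)) → Summable fun i => g (φ i) (w i)

namespace SummabilityTransfers

variable {P : Type*} {B : ℕ → Set P} {f g : ℕ → P → ℝ}

theorem exists_lower_bound (h : SummabilityTransfers B f g) (hf : ∀ j w, 0 ≤ f j w) {c : ℝ}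
    (hc : 0 < c) : ∃ D > 0, ∀ᶠ j in atTop, ∀ w ∈ B j, c ≤ g j w → D ≤ f j w := by
  by_contra! hcon
  have hsmall : ∀ k : ℕ, ∃ᶠ j in atTop, ∃ w ∈ B j, c ≤ g j w ∧ f j w < (1 / 2) ^ k := fun k =>
    hcon _ (by positivity)
  obtain ⟨φ, hφ, hP⟩ := exists_injective_of_frequently hsmall
  choose w hw hg hfw using hP
  have hsum : Summable fun k => g (φ k) (w k) := h φ hφ w hw <|
    summable_geometric_two.of_nonneg_of_le (fun k => hf _ _) fun k => (hfw k).le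
  obtain ⟨k, hk⟩ := (hsum.tendsto_atTop_zero.eventually (gt_mem_nhds hc)).exists
  exact hk.not_ge (hg k)

theorem exists_eventually_mul_lt (h : SummabilityTransfers B f g) (hf : ∀ j w, 0 ≤ f j w)
    (M : ℝ) : ∃ ε > 0, ∀ γ, 0 < γ → γ ≤ M → ∀ w, (∀ᶠ j in atTop, w ∈ B j) →
      ∀ᶠ j in atTop, γ ≤ g j w → ε * γ < f j w := by
  by_contra! hcon
  choose γ hγ hγM w hw hfg using fun k : ℕ => hcon ((1 / 2) ^ k) (by positivity)
  -- Placing `w k` at `⌈1 / γ k⌉` coordinates makes the `k`-th block contribute at least `1` to the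
  -- sum of `g`, but at most a multiple of `2⁻ᵏ` to the sum of `f`.
  let mult : ℕ → ℕ := fun k => ⌈(γ k)⁻¹⌉₊
  obtain ⟨φ, hφ, hP⟩ := exists_injective_of_frequently fun i : Σ k, Fin (mult k) =>
    (hfg i.1).and_eventually (hw i.1)
  have hfsum : Summable fun i => f (φ i) (w i.1) := by
    suffices hgeom : Summable fun i : Σ k, Fin (mult k) => (1 / 2) ^ i.1 * γ i.1 from
      hgeom.of_nonneg_of_le (fun i => hf _ _) fun i => (hP i).1.2
    have hnonneg : ∀ k, 0 ≤ (1 / 2) ^ k * γ k := fun k => mul_nonneg (by positivity) (hγ k).le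
    refine (summable_sigma_fin_iff (f := fun k => (1 / 2) ^ k * γ k) hnonneg).2 <|
      (summable_geometric_two.mul_right (1 + M)).of_nonneg_of_le
        (fun k => mul_nonneg (Nat.cast_nonneg _) (hnonneg k)) fun k => ?_
    calc (mult k : ℝ) * ((1 / 2) ^ k * γ k) ≤ ((γ k)⁻¹ + 1) * ((1 / 2) ^ k * γ k) :=
          mul_le_mul_of_nonneg_right
            (Nat.ceil_lt_add_one (inv_nonneg.2 (hγ k).le)).le (hnonneg k)
      _ = (1 / 2) ^ k * (1 + γ k) := by
          have := (hγ k).ne'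
          field_simp
      _ ≤ (1 / 2) ^ k * (1 + M) := by gcongr; exact hγM k
  have hgsum : Summable fun k => mult k * γ k := (summable_sigma_fin_iff fun k => (hγ k).le).1 <|
    (h φ hφ _ (fun i => (hP i).2) hfsum).of_nonneg_of_le (fun i => (hγ i.1).le)
      fun i => (hP i).1.1
  obtain ⟨k, hk⟩ := (hgsum.tendsto_atTop_zero.eventually (gt_mem_nhds one_pos)).exists
  exact hk.not_ge ((inv_le_iff_one_le_mul₀ (hγ k)).1 (Nat.le_ceil _))

end SummabilityTransfers

theorem HolderComparable.of_rpow {C p q A D s t : ℝ} (hq : 0 < q) (hA : 0 < A) (hD : 0 ≤ D)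
    (hs : 0 ≤ s) (ht : 0 ≤ t) (h : HolderComparable C p A D s (t ^ q)) :
    HolderComparable C (p / q) (A ^ q⁻¹) (D ^ q⁻¹) s t := by
  have hroot : ∀ c : ℝ, 0 ≤ c → (c * s ^ p) ^ q⁻¹ = c ^ q⁻¹ * s ^ (p / q) := fun c hc => by
    rw [Real.mul_rpow hc (by positivity), ← Real.rpow_mul hs, div_eq_mul_inv]
  refine ⟨fun hCs => (Real.rpow_inv_le_iff_of_pos hD ht hq).2 (h.1 hCs), fun hsC => ⟨?_, ?_⟩⟩
  · rw [← Real.inv_rpow hA.le, ← hroot _ (by positivity),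
      Real.rpow_inv_le_iff_of_pos (by positivity) ht hq]
    exact (h.2 hsC).1
  · rw [← hroot _ hA.le, Real.le_rpow_inv_iff_of_pos ht (by positivity) hq]
    exact (h.2 hsC).2

theorem Link.of_dense {X : Type*} [PseudoMetricSpace X] {C : ℝ} (h : Link X C) {s : Set X}
    (hs : Dense s) : Link s C := by
  intro ε hε
  obtain ⟨N, hN, hchain⟩ := h (ε / 3) (by positivity)
  have hnear : ∀ x : X, ∃ a : s, dist x a < ε / 3 ∧ (x ∈ s → a.1 = x) := fun x => by
    by_cases hx : x ∈ s
    · exact ⟨⟨x, hx⟩, by simpa using hε, fun _ => rfl⟩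
    · obtain ⟨a, ha, hxa⟩ := hs.exists_dist_lt x (by positivity : 0 < ε / 3)
      exact ⟨⟨a, ha⟩, hxa, fun h => (hx h).elim⟩
  choose a ha has using hnear
  refine ⟨N, hN, fun u v huv => ?_⟩
  obtain ⟨r, hr0, hrN, hr⟩ := hchain u v huv
  refine ⟨fun i => a (r i), Subtype.ext ?_, Subtype.ext ?_, fun i hi => ?_⟩
  · simp only [hr0, has _ u.2]
  · simp only [hrN, has _ v.2]
  · calc dist (a (r i)).1 (a (r (i + 1)))
        ≤ dist (a (r i)).1 (r i) + dist (r i) (r (i + 1)) + dist (r (i + 1)) (a (r (i + 1))) :=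
          dist_triangle4 _ _ _ _
      _ < ε := by rw [dist_comm (a (r i)).1]; linarith [ha (r i), ha (r (i + 1)), hr i hi]

namespace IsFiniteExhaustion

variable {X : Type*} [TopologicalSpace X] {F : ℕ → Set X}

theorem eventually_mem (hF : IsFiniteExhaustion F) {u : X} (hu : u ∈ ⋃ n, F n) :
    ∀ᶠ j in atTop, u ∈ F j := by
  obtain ⟨n, hn⟩ := Set.mem_iUnion.1 hu
  exact eventually_atTop.2 ⟨n, fun m hm => hF.mono hm hn⟩

theorem comp (hF : IsFiniteExhaustion F) {n : ℕ → ℕ} (hn : StrictMono n) :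
    IsFiniteExhaustion fun j => F (n j) where
  finite _ := hF.finite _
  nonempty _ := hF.nonempty _
  mono _ _ h := hF.mono (hn.monotone h)
  dense := hF.dense.mono (Set.iUnion_mono fun _ => hF.mono hn.le_apply)

end IsFiniteExhaustion

namespace ReducesCoordinatewise

variable {X E : Type*} [PseudoMetricSpace E] {F : ℕ → Set X} {S : ℕ → X → E} {p q C : ℝ}

theorem summabilityTransfers [PseudoMetricSpace X]
    (h : ReducesCoordinatewise (fun j (u : F j) => S j u) p q) (hp : 0 < p) (hq : 0 < q)
    (hF : ∀ j, (F j).Nonempty) :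
    SummabilityTransfers (fun j => F j ×ˢ F j) (fun _ w => dist w.1 w.2 ^ p)
        (fun j w => dist (S j w.1) (S j w.2) ^ q) ∧
      SummabilityTransfers (fun j => F j ×ˢ F j) (fun j w => dist (S j w.1) (S j w.2) ^ q)
        (fun _ w => dist w.1 w.2 ^ p) := by
  have : ∀ j, Nonempty (F j) := fun j => (hF j).to_subtype
  have key := fun {ι : Type} {φ : ι → ℕ} (hφ : Injective φ) (w : ι → X × X)
      (hw : ∀ i, w i ∈ F (φ i) ×ˢ F (φ i)) =>
    h.summable_iff_of_injective hp hq hφ (fun i => ⟨(w i).1, (hw i).1⟩)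
      fun i => ⟨(w i).2, (hw i).2⟩
  exact ⟨fun ι φ hφ w hw => (key hφ w hw).1, fun ι φ hφ w hw => (key hφ w hw).2⟩

theorem exists_eventually_dist_le_of_link [PseudoMetricSpace X]
    (h : ReducesCoordinatewise (fun j (u : F j) => S j u) p q) (hp : 0 < p) (hq : 0 < q)
    (hF : IsFiniteExhaustion F) (hlink : Link X C) :
    ∃ N : ℕ, ∀ u ∈ ⋃ n, F n, ∀ v ∈ ⋃ n, F n, dist u v < C →
      ∀ᶠ j in atTop, dist (S j u) (S j v) ≤ N := by
  obtain ⟨δ, hδ, hstep⟩ := (h.summabilityTransfers hp hq hF.nonempty).1.exists_lower_bound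
    (fun _ _ => by positivity) one_pos
  obtain ⟨N, -, hN⟩ := hlink.of_dense hF.dense (δ ^ p⁻¹) (by positivity)
  refine ⟨N, fun u hu v hv huv => ?_⟩
  obtain ⟨r, hr0, hrN, hr⟩ := hN ⟨u, hu⟩ ⟨v, hv⟩ huv
  have hmem : ∀ᶠ j in atTop, ∀ i ∈ Finset.range (N + 1), (r i).1 ∈ F j :=
    (eventually_all_finset _).2 fun i _ => hF.eventually_mem (r i).2
  filter_upwards [hstep, hmem] with j hstep hmem
  have hle : ∀ {i}, i < N → dist (S j (r i)) (S j (r (i + 1))) ≤ 1 := fun {i} hi => by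
    by_contra! hgt
    refine (hstep ((r i).1, (r (i + 1)).1) ⟨hmem i ?_, hmem (i + 1) ?_⟩
      (Real.one_le_rpow hgt.le hq.le)).not_gt ?_
    · exact Finset.mem_range.2 (by lia)
    · exact Finset.mem_range.2 (by lia)
    · exact (Real.lt_rpow_inv_iff_of_pos dist_nonneg hδ.le hp).1 (hr i hi)
  have hsum := dist_le_range_sum_of_dist_le (f := fun i => S j (r i)) N hle
  simpa [hr0, hrN] using hsum

theorem exists_eventually_rpow_dist_le [PseudoMetricSpace X]
    (h : ReducesCoordinatewise (fun j (u : F j) => S j u) p q) (hp : 0 < p) (hq : 0 < q)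
    (hF : IsFiniteExhaustion F) (hlink : Link X C) :
    ∃ A > 0, ∀ u ∈ ⋃ n, F n, ∀ v ∈ ⋃ n, F n, 0 < dist u v → dist u v < C →
      ∀ᶠ j in atTop, dist (S j u) (S j v) ^ q ≤ A * dist u v ^ p := by
  obtain ⟨N, hN⟩ := h.exists_eventually_dist_le_of_link hp hq hF hlink
  obtain ⟨ε, hε, hlt⟩ := (h.summabilityTransfers hp hq hF.nonempty).1.exists_eventually_mul_lt
    (fun _ _ => by positivity) ((N : ℝ) ^ q)
  refine ⟨ε⁻¹, by positivity, fun u hu v hv hpos huv => ?_⟩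
  rcases le_or_gt (ε⁻¹ * dist u v ^ p) ((N : ℝ) ^ q) with hle | hgt
  · filter_upwards [hlt _ (by positivity) hle (u, v)
      ((hF.eventually_mem hu).and (hF.eventually_mem hv))] with j hj
    by_contra! hcon
    exact (hj hcon.le).ne (mul_inv_cancel_left₀ hε.ne' _)
  · filter_upwards [hN u hu v hv huv] with j hj
    exact (Real.rpow_le_rpow dist_nonneg hj hq.le).trans hgt.le

theorem exists_eventually_holderComparable [MetricSpace X]
    (h : ReducesCoordinatewise (fun j (u : F j) => S j u) p q) (hp : 0 < p) (hq : 0 < q)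
    (hC : 0 < C) (hF : IsFiniteExhaustion F) (hlink : Link X C) :
    ∃ A D : ℝ, 0 < A ∧ 0 < D ∧ ∀ u v : ⋃ n, F n, ∀ᶠ j in atTop,
      HolderComparable C p A D (dist u v) (dist (S j u) (S j v) ^ q) := by
  have hback := (h.summabilityTransfers hp hq hF.nonempty).2
  obtain ⟨A, hA, hupper⟩ := h.exists_eventually_rpow_dist_le hp hq hF hlink
  obtain ⟨ε, hε, hlower⟩ := hback.exists_eventually_mul_lt (fun _ _ => by positivity) (C ^ p)
  obtain ⟨D, hD, hsep⟩ := hback.exists_lower_bound (fun _ _ => by positivity)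
    (Real.rpow_pos_of_pos hC p)
  refine ⟨max A ε⁻¹, D, lt_max_of_lt_left hA, hD, fun u v => ?_⟩
  have hmem : ∀ᶠ j in atTop, (u.1, v.1) ∈ F j ×ˢ F j :=
    (hF.eventually_mem u.2).and (hF.eventually_mem v.2)
  rcases eq_or_ne u v with rfl | huv
  · simp [HolderComparable, hC.not_ge, Real.zero_rpow, hp.ne', hq.ne']
  have hpos : 0 < dist u v := dist_pos.2 huv
  rcases le_or_gt C (dist u v) with hCd | hdC
  · filter_upwards [hsep, hmem] with j hsep hmem
    exact ⟨fun _ => hsep _ hmem (Real.rpow_le_rpow hC.le hCd hp.le), fun h => (hCd.not_gt h).elim⟩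
  · have hdCp : dist u v ^ p ≤ C ^ p := Real.rpow_le_rpow hpos.le hdC.le hp.le
    filter_upwards [hupper u u.2 v v.2 hpos hdC, hlower _ (by positivity) hdCp (u.1, v.1) hmem]
      with j hupper hlower
    refine ⟨fun h => (hdC.not_ge h).elim, fun _ => ⟨?_, hupper.trans ?_⟩⟩
    · exact (mul_le_mul_of_nonneg_right (inv_le_of_inv_le₀ hε (le_max_right _ _))
        (by positivity)).trans (hlower le_rfl).le
    · exact mul_le_mul_of_nonneg_right (le_max_left _ _) (by positivity)

theorem finitelyHolderEmbeds [MetricSpace X]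
    (h : ReducesCoordinatewise (fun j (u : F j) => S j u) p q) (hp : 0 < p) (hq : 0 < q)
    (hC : 0 < C) (hF : IsFiniteExhaustion F) (hlink : Link X C) :
    FinitelyHolderEmbeds X E C (p / q) := by
  obtain ⟨A, D, hA, hD, hcomp⟩ := h.exists_eventually_holderComparable hp hq hC hF hlink
  have hunion : FinitelyHolderEmbeds (⋃ n, F n : Set X) E C (p / q) := by
    refine ⟨A ^ q⁻¹, D ^ q⁻¹, by positivity, by positivity, fun K => ?_⟩
    obtain ⟨j, hj⟩ := (eventually_all.2 fun u : K => eventually_all.2 fun v : K =>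
      hcomp u v).exists
    exact ⟨fun u => S j u, fun u v => (hj u v).of_rpow hq hA hD.le dist_nonneg dist_nonneg⟩
  exact hunion.of_finitelyRepresentable_source (finitelyRepresentable_of_dense hF.dense) hC
    (div_pos hp hq)

end ReducesCoordinatewise

/-! ### Borel maps near a generic point -/

theorem exists_isOpen_dense_seq_forall_mem_nhdsWithin {P : Type*} [TopologicalSpace P]
    [MeasurableSpace P] [BorelSpace P] {ι : Type*} [Countable ι] {B : ι → Set P}
    (hB : ∀ i, MeasurableSet (B i)) :
    ∃ O : ℕ → Set P, (∀ k, IsOpen (O k)) ∧ (∀ k, Dense (O k)) ∧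
      ∀ i, ∀ x ∈ B i, x ∈ ⋂ k, O k → B i ∈ 𝓝[⋂ k, O k] x := by
  choose V hVo hBV using fun i => (hB i).residualEq_isOpen
  have hagree : {x | ∀ i, x ∈ B i ↔ x ∈ V i} ∈ residual P :=
    eventually_countable_forall.2 fun i => (hBV i).mem_iff
  obtain ⟨T, hTo, hTd, hTc, hT⟩ := mem_residual_iff.1 hagree
  obtain ⟨O, hO⟩ := (hTc.insert Set.univ).exists_eq_range (Set.insert_nonempty _ _)
  have hmem : ∀ k, O k = Set.univ ∨ O k ∈ T := fun k =>
    Set.mem_insert_iff.1 (hO ▸ Set.mem_range_self k)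
  have hagreeO : ∀ x ∈ ⋂ k, O k, ∀ i, x ∈ B i ↔ x ∈ V i := fun x hx => hT fun t ht => by
    obtain ⟨k, rfl⟩ : t ∈ Set.range O := hO ▸ Set.mem_insert_of_mem _ ht
    exact Set.mem_iInter.1 hx k
  refine ⟨O, fun k => ?_, fun k => ?_, fun i x hxB hx => ?_⟩
  · exact (hmem k).elim (fun h => h ▸ isOpen_univ) (hTo _)
  · exact (hmem k).elim (fun h => h ▸ dense_univ) (hTd _)
  · filter_upwards [self_mem_nhdsWithin,
      mem_nhdsWithin_of_mem_nhds ((hVo i).mem_nhds ((hagreeO x hx i).1 hxB))] with y hy hyV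
    exact (hagreeO y hy i).2 hyV

theorem eventually_forall_sum_Ico_le {f : ℕ → ℝ} (hs : Summable f) (hf : ∀ i, 0 ≤ f i) {ε : ℝ}
    (hε : 0 < ε) : ∀ᶠ k in atTop, ∀ L, ∑ i ∈ Finset.Ico k L, f i ≤ ε := by
  filter_upwards [(tendsto_sum_nat_add f).eventually (gt_mem_nhds hε)] with k hk L
  rw [Finset.sum_Ico_eq_sum_range]
  simp only [add_comm k]
  exact (((summable_nat_add_iff k).2 hs).sum_le_tsum _ fun i _ => hf _).trans hk.le

section Cylinders

variable {K : ℕ → Type*}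

theorem finite_setOf_updateFinset_ne (x : ∀ n, K n) (s : Finset ℕ)
    (u v : ∀ i : s, K i) : {i | updateFinset x s u i ≠ updateFinset x s v i}.Finite :=
  s.finite_toSet.subset fun i hi => by_contra fun his => hi (by
    have : i ∉ s := his
    simp [updateFinset, this])

variable [∀ n, TopologicalSpace (K n)]

theorem continuous_updateFinset_left (s : Finset ℕ) (u : ∀ i : s, K i) :
    Continuous fun x : ∀ i, K i => updateFinset x s u := by
  refine continuous_pi fun i => ?_
  by_cases hi : i ∈ s
  · simpa [updateFinset, hi] using continuous_const
  · simpa [updateFinset, hi] using continuous_apply i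

variable [∀ n, DiscreteTopology (K n)]

theorem eventually_cylinder_subset {s : Set (∀ n, K n)} {a : ∀ n, K n} (hs : s ∈ 𝓝 a) :
    ∀ᶠ N in atTop, PiNat.cylinder a N ⊆ s := by
  obtain ⟨_, ⟨b, n, rfl⟩, hab, hbs⟩ := (PiNat.isTopologicalBasis_cylinders K).mem_nhds_iff.1 hs
  filter_upwards [eventually_ge_atTop n] with N hN
  rw [← PiNat.mem_cylinder_iff_eq.1 hab] at hbs
  exact (PiNat.cylinder_anti a hN).trans hbs

theorem dense_preimage_updateFinset {O : Set (∀ n, K n)} (hO : Dense O) (s : Finset ℕ)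
    (u : ∀ i : s, K i) : Dense ((fun x => updateFinset x s u) ⁻¹' O) := by
  rw [(PiNat.isTopologicalBasis_cylinders K).dense_iff]
  rintro _ ⟨b, n, rfl⟩ -
  obtain ⟨m, hm⟩ := s.exists_nat_subset_range
  obtain ⟨z, hz, hzO⟩ := hO.inter_open_nonempty _
    (PiNat.isOpen_cylinder K (updateFinset b s u) (max n m)) ⟨_, PiNat.self_mem_cylinder _ _⟩
  rw [PiNat.mem_cylinder_iff] at hz
  refine ⟨updateFinset z s (s.restrict b), ?_, ?_⟩
  · rw [PiNat.mem_cylinder_iff]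
    intro i hi
    by_cases his : i ∈ s
    · simp [updateFinset, his]
    · simp [updateFinset, his, hz i (lt_max_of_lt_left hi)]
  · have hrestrict : s.restrict z = u := funext fun i => by
      have him := Finset.mem_range.1 (hm i.2)
      simp [updateFinset, hz i (lt_max_of_lt_right him)]
    rwa [Set.mem_preimage, updateFinset_updateFinset_of_subset subset_rfl, ← hrestrict,
      updateFinset_restrict]

theorem exists_forall_updateFinset_mem [∀ n, Finite (K n)] [∀ n, Nonempty (K n)]
    {O : ℕ → Set (∀ n, K n)} (hO : ∀ k, IsOpen (O k)) (hOd : ∀ k, Dense (O k)) :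
    ∃ a : ∀ n, K n, ∀ (s : Finset ℕ) (u : ∀ i : s, K i), updateFinset a s u ∈ ⋂ k, O k := by
  obtain ⟨a, ha⟩ := (dense_iInter_of_isOpen
    (f := fun t : ℕ × Σ s : Finset ℕ, ∀ i : s, K i =>
      (fun x => updateFinset x t.2.1 t.2.2) ⁻¹' O t.1)
    (fun t => (hO t.1).preimage (continuous_updateFinset_left _ _))
    fun t => dense_preimage_updateFinset (hOd t.1) _ _).nonempty
  exact ⟨a, fun s u => Set.mem_iInter.2 fun k => Set.mem_iInter.1 ha (k, ⟨s, u⟩)⟩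

end Cylinders

section Genericity

variable {K W : ℕ → Type*} [∀ n, PseudoMetricSpace (W n)] {q : ℝ}

/-- The sequences `x` for which changing the first `m` entries of `x` from `u` to `v` moves the
coordinates of `θ x` from `l` on by at most `ε`, in the sense of `∑ d^q`. -/
def smallTail (θ : (∀ n, K n) → ∀ n, W n) (q ε : ℝ) (l : ℕ) {m : ℕ}
    (u v : ∀ i : Finset.range m, K i) : Set (∀ n, K n) :=
  {x | ∀ L, ∑ i ∈ Finset.Ico l L, dist (θ (updateFinset x (Finset.range m) u) i)
    (θ (updateFinset x (Finset.range m) v) i) ^ q ≤ ε}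

/-- The control over `θ` near `a` that the fusion argument needs at stage `m`. On `⋂ O_k`, the
coordinates of `θ x` from `l` on almost do not depend on the first `m` entries of `x`, and the
coordinates before `l` are almost determined by the first `N` entries; these also force `x` into
`O_0, …, O_m`. Here `x` is required to follow `a` on `[m, N)`, and `almost` means up to `2⁻ᵐ`. -/
structure BlockControl (θ : (∀ n, K n) → ∀ n, W n) (q : ℝ) (O : ℕ → Set (∀ n, K n))
    (a : ∀ n, K n) (m l N : ℕ) : Prop where
  le_left : m ≤ l
  le_right : l ≤ N
  mem_smallTail : ∀ u v : ∀ i : Finset.range m, K i, ∀ x ∈ ⋂ k, O k, x ∈ PiNat.cylinder a N →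
    x ∈ smallTail θ q ((1 / 2) ^ m) l u v
  sum_head_le : ∀ u : ∀ i : Finset.range m, K i, ∀ x ∈ ⋂ k, O k,
    x ∈ PiNat.cylinder (updateFinset a (Finset.range m) u) N →
    ∑ i ∈ Finset.range l, dist (θ x i) (θ (updateFinset a (Finset.range m) u) i) ^ q ≤ (1 / 2) ^ m
  cylinder_subset : ∀ u : ∀ i : Finset.range m, K i, ∀ k ≤ m,
    PiNat.cylinder (updateFinset a (Finset.range m) u) N ⊆ O k

theorem measurableSet_smallTail [∀ n, MeasurableSpace (K n)] [∀ n, MeasurableSpace (W n)]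
    [∀ n, OpensMeasurableSpace (W n)] [∀ n, SecondCountableTopology (W n)]
    {θ : (∀ n, K n) → ∀ n, W n} (hθ : Measurable θ) (q ε : ℝ) (l : ℕ) {m : ℕ}
    (u v : ∀ i : Finset.range m, K i) : MeasurableSet (smallTail θ q ε l u v) := by
  have hcoord : ∀ (w : ∀ i : Finset.range m, K i) (i : ℕ),
      Measurable fun x => θ (updateFinset x (Finset.range m) w) i := fun w i =>
    (measurable_pi_apply i).comp (hθ.comp measurable_updateFinset_left)
  rw [smallTail, Set.ofPred_forall]
  exact MeasurableSet.iInter fun L => measurableSet_le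
    (Finset.measurable_fun_sum _ fun i _ => ((hcoord u i).dist (hcoord v i)).pow_const q)
    measurable_const

theorem continuousOn_of_preimage_mem_nhdsWithin {P Q : Type*} [TopologicalSpace P]
    [TopologicalSpace Q] {b : Set (Set Q)} (hb : TopologicalSpace.IsTopologicalBasis b) {θ : P → Q}
    {G : Set P} (h : ∀ s ∈ b, ∀ x ∈ θ ⁻¹' s, x ∈ G → θ ⁻¹' s ∈ 𝓝[G] x) : ContinuousOn θ G :=
  fun x hx => hb.nhds_hasBasis.tendsto_right_iff.2 fun s hs => h s hs.1 x hs.2 hx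

variable [∀ n, TopologicalSpace (K n)] [∀ n, DiscreteTopology (K n)]

theorem exists_continuousOn_smallTail_mem_nhdsWithin [∀ n, Finite (K n)]
    [∀ n, MeasurableSpace (K n)] [∀ n, BorelSpace (K n)]
    [∀ n, MeasurableSpace (W n)] [∀ n, OpensMeasurableSpace (W n)]
    [∀ n, SecondCountableTopology (W n)] {θ : (∀ n, K n) → ∀ n, W n} (hθ : Measurable θ) (q : ℝ) :
    ∃ O : ℕ → Set (∀ n, K n), (∀ k, IsOpen (O k)) ∧ (∀ k, Dense (O k)) ∧
      ContinuousOn θ (⋂ k, O k) ∧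
      ∀ (l m : ℕ) (u v : ∀ i : Finset.range m, K i), ∀ x ∈ smallTail θ q ((1 / 2) ^ m) l u v,
        x ∈ ⋂ k, O k → smallTail θ q ((1 / 2) ^ m) l u v ∈ 𝓝[⋂ k, O k] x := by
  let b := TopologicalSpace.countableBasis (∀ n, W n)
  have : Countable b := (TopologicalSpace.countable_countableBasis _).to_subtype
  obtain ⟨O, hO, hOd, hB⟩ := exists_isOpen_dense_seq_forall_mem_nhdsWithin
    (ι := b ⊕ Σ t : ℕ × ℕ, (∀ i : Finset.range t.2, K i) × (∀ i : Finset.range t.2, K i))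
    (B := Sum.elim (fun s => θ ⁻¹' s)
      fun t => smallTail θ q ((1 / 2) ^ t.1.2) t.1.1 t.2.1 t.2.2) (by
      rintro (s | t)
      · exact hθ (TopologicalSpace.isOpen_of_mem_countableBasis s.2).measurableSet
      · exact measurableSet_smallTail hθ _ _ _ _ _)
  refine ⟨O, hO, hOd, ?_, fun l m u v => hB (.inr ⟨(l, m), u, v⟩)⟩
  exact continuousOn_of_preimage_mem_nhdsWithin (TopologicalSpace.isBasis_countableBasis _)
    fun s hs => hB (.inl ⟨s, hs⟩)

theorem eventually_forall_mem_cylinder {G s : Set (∀ n, K n)} {a : ∀ n, K n} (hs : s ∈ 𝓝[G] a) :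
    ∀ᶠ N in atTop, ∀ x ∈ G, x ∈ PiNat.cylinder a N → x ∈ s :=
  (eventually_cylinder_subset (mem_nhdsWithin_iff_eventually.1 hs)).mono fun _ hN _ hxG hx =>
    hN hx hxG

theorem sum_range_dist_rpow_mem_nhdsWithin {P : Type*} [TopologicalSpace P] {θ : P → ∀ n, W n}
    {G : Set P} {b : P} (hθ : ContinuousWithinAt θ G b) (hq : 0 < q) (l : ℕ) {ε : ℝ} (hε : 0 < ε) :
    {x | ∑ i ∈ Finset.range l, dist (θ x i) (θ b i) ^ q ≤ ε} ∈ 𝓝[G] b := by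
  have hcont : ContinuousWithinAt
      (fun x => ∑ i ∈ Finset.range l, dist (θ x i) (θ b i) ^ q) G b :=
    tendsto_finsetSum _ fun i _ => ((continuousWithinAt_pi.1 hθ i).dist
      continuousWithinAt_const).rpow_const (.inr hq.le)
  filter_upwards [hcont.eventually (gt_mem_nhds (by simpa [hq.ne'] using hε))] with x hx
  exact hx.le

theorem exists_blockControl [∀ n, Finite (K n)] [∀ n, Nonempty (K n)]
    [∀ n, MeasurableSpace (K n)] [∀ n, BorelSpace (K n)]
    [∀ n, MeasurableSpace (W n)] [∀ n, OpensMeasurableSpace (W n)]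
    [∀ n, SecondCountableTopology (W n)] {θ : (∀ n, K n) → ∀ n, W n} (hθ : Measurable θ)
    (hq : 0 < q)
    (hfin : ∀ x y, {i | x i ≠ y i}.Finite → Summable fun i => dist (θ x i) (θ y i) ^ q) :
    ∃ (a : ∀ n, K n) (O : ℕ → Set (∀ n, K n)), ∀ m, ∃ l N, BlockControl θ q O a m l N := by
  obtain ⟨O, hO, hOd, hcont, htail⟩ := exists_continuousOn_smallTail_mem_nhdsWithin hθ q
  obtain ⟨a, ha⟩ := exists_forall_updateFinset_mem hO hOd
  have haO : a ∈ ⋂ k, O k := by simpa using ha ∅ fun i => a i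
  refine ⟨a, O, fun m => ?_⟩
  have hl : ∀ᶠ l in atTop, ∀ u v : ∀ i : Finset.range m, K i,
      a ∈ smallTail θ q ((1 / 2) ^ m) l u v :=
    eventually_all.2 fun u => eventually_all.2 fun v => eventually_forall_sum_Ico_le
      (hfin _ _ (finite_setOf_updateFinset_ne a _ u v)) (fun i => by positivity) (by positivity)
  obtain ⟨l, hl, hml⟩ := (hl.and (eventually_ge_atTop m)).exists
  have htails : ∀ᶠ N in atTop, ∀ u v : ∀ i : Finset.range m, K i, ∀ x ∈ ⋂ k, O k,
      x ∈ PiNat.cylinder a N → x ∈ smallTail θ q ((1 / 2) ^ m) l u v :=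
    eventually_all.2 fun u => eventually_all.2 fun v =>
      eventually_forall_mem_cylinder (htail l m u v a (hl u v) haO)
  have hheads : ∀ᶠ N in atTop, ∀ u : ∀ i : Finset.range m, K i, ∀ x ∈ ⋂ k, O k,
      x ∈ PiNat.cylinder (updateFinset a (Finset.range m) u) N →
      ∑ i ∈ Finset.range l, dist (θ x i) (θ (updateFinset a (Finset.range m) u) i) ^ q ≤
        (1 / 2) ^ m :=
    eventually_all.2 fun u => eventually_forall_mem_cylinder
      (sum_range_dist_rpow_mem_nhdsWithin (hcont _ (ha _ u)) hq l (by positivity))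
  have hcylinders : ∀ᶠ N in atTop, ∀ u : ∀ i : Finset.range m, K i, ∀ k ∈ Set.Iic m,
      PiNat.cylinder (updateFinset a (Finset.range m) u) N ⊆ O k :=
    eventually_all.2 fun u => (eventually_all_finite (Set.finite_Iic m)).2 fun k _ =>
      eventually_cylinder_subset ((hO k).mem_nhds (Set.mem_iInter.1 (ha _ u) k))
  obtain ⟨N, htailN, hheadN, hcylN, hlN⟩ :=
    (htails.and (hheads.and (hcylinders.and (eventually_ge_atTop l)))).exists
  exact ⟨l, N, hml, hlN, htailN, hheadN, hcylN⟩

end Genericity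

/-! ### Fusion along a generic point -/

/-- The successive stages of the fusion: when the stage `m` uses the coordinates below `N m`, the
coordinate `N m` is left free, and the next stage starts right after it. -/
def fusionStage (N : ℕ → ℕ) : ℕ → ℕ
  | 0 => 0
  | j + 1 => N (fusionStage N j) + 1

section Fusion

theorem strictMono_comp_fusionStage {l N : ℕ → ℕ} (hl : ∀ m, m ≤ l m) (hlN : ∀ m, l m ≤ N m) :
    StrictMono (l ∘ fusionStage N) :=
  strictMono_nat_of_lt_succ fun j => (hlN _).trans_lt (hl (fusionStage N (j + 1)))

variable {N : ℕ → ℕ} (hN : ∀ m, m ≤ N m)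

include hN

theorem strictMono_fusionStage : StrictMono (fusionStage N) :=
  strictMono_comp_fusionStage (l := id) (fun _ => le_rfl) hN

theorem notMem_range_of_fusionStage_le {i j : ℕ} (h₁ : fusionStage N j ≤ i)
    (h₂ : i < fusionStage N (j + 1)) (h₃ : i ≠ N (fusionStage N j)) :
    i ∉ Set.range (N ∘ fusionStage N) := by
  rintro ⟨k, rfl⟩
  rcases lt_trichotomy k j with hkj | rfl | hjk
  · exact h₁.not_gt ((strictMono_fusionStage hN).monotone (Nat.succ_le_of_lt hkj))
  · exact h₃ rfl
  · exact h₂.not_ge (((strictMono_fusionStage hN).monotone (Nat.succ_le_of_lt hjk)).trans (hN _))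

variable {K : ℕ → Type*} {a x : ∀ n, K n} (hx : ∀ i ∉ Set.range (N ∘ fusionStage N), x i = a i)

include hx

theorem mem_cylinder_updateFinset_fusionStage (j : ℕ) :
    x ∈ PiNat.cylinder (updateFinset a (Finset.range (fusionStage N j))
      ((Finset.range (fusionStage N j)).restrict x)) (N (fusionStage N j)) := by
  rw [PiNat.mem_cylinder_iff]
  intro i hi
  by_cases him : i < fusionStage N j
  · simp [updateFinset, him]
  · simpa [updateFinset, him] using
      hx i (notMem_range_of_fusionStage_le hN (not_lt.1 him) (Nat.lt_succ_of_lt hi) hi.ne)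

theorem updateFinset_update_fusionStage (j : ℕ) :
    updateFinset (update a (N (fusionStage N j)) (x (N (fusionStage N j))))
        (Finset.range (fusionStage N j)) ((Finset.range (fusionStage N j)).restrict x) =
      updateFinset a (Finset.range (fusionStage N (j + 1)))
        ((Finset.range (fusionStage N (j + 1))).restrict x) := by
  have hlt : fusionStage N j < fusionStage N (j + 1) := strictMono_fusionStage hN j.lt_succ_self
  funext i
  rcases lt_or_ge i (fusionStage N j) with him | him
  · simp [updateFinset, him, him.trans hlt]
  by_cases hiN : i = N (fusionStage N j)
  · subst hiN
    simp [updateFinset, him.not_gt, fusionStage]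
  rcases lt_or_ge i (fusionStage N (j + 1)) with him' | him'
  · simp [updateFinset, him.not_gt, him', hiN,
      hx i (notMem_range_of_fusionStage_le hN him him' hiN)]
  · simp [updateFinset, him.not_gt, him'.not_gt, hiN]

end Fusion

theorem summable_iff_summable_sum_Ico {f : ℕ → ℝ} (hf : ∀ i, 0 ≤ f i) {l : ℕ → ℕ}
    (hl : StrictMono l) :
    Summable f ↔ Summable fun j => ∑ i ∈ Finset.Ico (l j) (l (j + 1)), f i := by
  have hblocks : ∀ J, ∑ j ∈ Finset.range J, ∑ i ∈ Finset.Ico (l j) (l (j + 1)), f i =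
      ∑ i ∈ Finset.range (l J), f i - ∑ i ∈ Finset.range (l 0), f i := fun J => by
    rw [← Finset.sum_range_sub fun j => ∑ i ∈ Finset.range (l j), f i]
    exact Finset.sum_congr rfl fun j _ => Finset.sum_Ico_eq_sub _ (hl.monotone j.le_succ)
  have hnonneg : ∀ s : Finset ℕ, 0 ≤ ∑ i ∈ s, f i := fun s => Finset.sum_nonneg fun i _ => hf i
  refine ⟨fun h => summable_of_sum_range_le (c := ∑' i, f i) (fun j => hnonneg _) fun J => ?_,
    fun h => summable_of_sum_range_le (c := ∑' j, ∑ i ∈ Finset.Ico (l j) (l (j + 1)), f i +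
      ∑ i ∈ Finset.range (l 0), f i) hf fun J => ?_⟩
  · rw [hblocks]
    exact (sub_le_self _ (hnonneg _)).trans (h.sum_le_tsum _ fun i _ => hf i)
  · calc ∑ i ∈ Finset.range J, f i ≤ ∑ i ∈ Finset.range (l J), f i :=
          Finset.sum_le_sum_of_subset_of_nonneg (Finset.range_mono hl.le_apply) fun i _ _ => hf i
      _ = ∑ j ∈ Finset.range J, ∑ i ∈ Finset.Ico (l j) (l (j + 1)), f i +
          ∑ i ∈ Finset.range (l 0), f i := by rw [hblocks, sub_add_cancel]
      _ ≤ _ := by gcongr; exact h.sum_le_tsum _ fun j _ => hnonneg _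

/-- The sequence that coincides with `w j` on the block `[l j, l (j + 1))`, and with `w 0` before
`l 0`. -/
def concat {W : ℕ → Type*} (l : ℕ → ℕ) (w : ℕ → ∀ i, W i) : ∀ i, W i :=
  fun i => w (Nat.findGreatest (fun j => l j ≤ i) i) i

theorem concat_apply {W : ℕ → Type*} {l : ℕ → ℕ} (hl : StrictMono l) (w : ℕ → ∀ i, W i) {i j : ℕ}
    (hi : i ∈ Finset.Ico (l j) (l (j + 1))) : concat l w i = w j i := by
  obtain ⟨h₁, h₂⟩ := Finset.mem_Ico.1 hi
  suffices hj : Nat.findGreatest (fun j => l j ≤ i) i = j by rw [concat, hj]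
  refine Nat.findGreatest_eq_iff.2 ⟨hl.le_apply.trans h₁, fun _ => h₁, fun k hjk _ => ?_⟩
  exact (h₂.trans_le (hl.monotone hjk)).not_ge

theorem ellRel_concat_iff {W : ℕ → Type*} [∀ n, PseudoMetricSpace (W n)] {q : ℝ} (hq : 1 ≤ q)
    {l : ℕ → ℕ} (hl : StrictMono l) (w w' : ℕ → ∀ i, W i) :
    ellRel W hq (concat l w) (concat l w') ↔
      Summable fun j => ∑ i ∈ Finset.Ico (l j) (l (j + 1)), dist (w j i) (w' j i) ^ q := by
  refine (summable_iff_summable_sum_Ico (fun i => by positivity) hl).trans (Iff.of_eq ?_)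
  congr! 2 with j
  exact Finset.sum_congr rfl fun i hi => by rw [concat_apply hl w hi, concat_apply hl w' hi]

theorem ellRel_concat_of_le {W : ℕ → Type*} [∀ n, PseudoMetricSpace (W n)] {q : ℝ} (hq : 1 ≤ q)
    {l : ℕ → ℕ} (hl : StrictMono l) {w w' : ℕ → ∀ i, W i} {m : ℕ → ℕ} (hm : StrictMono m)
    (h : ∀ j, ∑ i ∈ Finset.Ico (l j) (l (j + 1)), dist (w j i) (w' j i) ^ q ≤ (1 / 2) ^ m j) :
    ellRel W hq (concat l w) (concat l w') :=
  (ellRel_concat_iff hq hl w w').2 <|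
    (summable_geometric_two.comp_injective hm.injective).of_nonneg_of_le
      (fun j => Finset.sum_nonneg fun i _ => by positivity) h

section Blocks

variable {K W : ℕ → Type*} [∀ n, PseudoMetricSpace (W n)] {q : ℝ} {θ : (∀ n, K n) → ∀ n, W n}

theorem BlockControl.ellRel_concat (hq : 1 ≤ q) {O : ℕ → Set (∀ n, K n)} {a : ∀ n, K n}
    {l N : ℕ → ℕ} (h : ∀ m, BlockControl θ q O a m (l m) (N m)) {x : ∀ n, K n}
    (hx : ∀ i ∉ Set.range (N ∘ fusionStage N), x i = a i) :
    ellRel W hq (θ x) (concat (l ∘ fusionStage N) fun j =>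
      θ (update a (N (fusionStage N j)) (x (N (fusionStage N j))))) := by
  have hN : ∀ m, m ≤ N m := fun m => (h m).le_left.trans (h m).le_right
  have hm := strictMono_fusionStage hN
  have hl : StrictMono (l ∘ fusionStage N) :=
    strictMono_comp_fusionStage (fun m => (h m).le_left) fun m => (h m).le_right
  have hgeneric : ∀ z : ∀ n, K n, (∀ i ∉ Set.range (N ∘ fusionStage N), z i = a i) →
      z ∈ ⋂ k, O k := fun z hz => Set.mem_iInter.2 fun k =>
    (h _).cylinder_subset _ k hm.le_apply (mem_cylinder_updateFinset_fusionStage hN hz k)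
  set y : ℕ → ∀ n, K n := fun j => updateFinset a (Finset.range (fusionStage N j))
    ((Finset.range (fusionStage N j)).restrict x)
  set z : ℕ → ∀ n, K n := fun j => update a (N (fusionStage N j)) (x (N (fusionStage N j)))
  have hzO : ∀ j, z j ∈ ⋂ k, O k := fun j => hgeneric _ fun i hi =>
    update_of_ne (fun hij => hi ⟨j, hij.symm⟩) _ _
  have hxy : ellRel W hq (concat (l ∘ fusionStage N) fun _ => θ x)
      (concat (l ∘ fusionStage N) fun j => θ (y (j + 1))) := by
    refine ellRel_concat_of_le hq hl (hm.comp (strictMono_id.add_const 1)) fun j => ?_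
    refine le_trans (Finset.sum_le_sum_of_subset_of_nonneg (fun i hi => ?_) fun i _ _ => ?_)
      ((h _).sum_head_le _ x (hgeneric x hx) (mem_cylinder_updateFinset_fusionStage hN hx (j + 1)))
    · exact Finset.mem_range.2 (Finset.mem_Ico.1 hi).2
    · positivity
  have hyz : ellRel W hq (concat (l ∘ fusionStage N) fun j => θ (y (j + 1)))
      (concat (l ∘ fusionStage N) fun j => θ (z j)) := by
    refine ellRel_concat_of_le hq hl hm fun j => ?_
    have := (h (fusionStage N j)).mem_smallTail ((Finset.range _).restrict x)
      ((Finset.range _).restrict (z j)) (z j) (hzO j) (PiNat.update_mem_cylinder _ _ _)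
      (l (fusionStage N (j + 1)))
    rwa [updateFinset_update_fusionStage hN hx, updateFinset_restrict] at this
  exact (ellRel W hq).trans hxy hyz

theorem exists_ellRel_concat_of_measurable [∀ n, Finite (K n)] [∀ n, Nonempty (K n)]
    [∀ n, TopologicalSpace (K n)] [∀ n, DiscreteTopology (K n)]
    [∀ n, MeasurableSpace (K n)] [∀ n, BorelSpace (K n)]
    [∀ n, MeasurableSpace (W n)] [∀ n, OpensMeasurableSpace (W n)]
    [∀ n, SecondCountableTopology (W n)] (hθ : Measurable θ) (hq : 1 ≤ q)
    (hfin : ∀ x y, {i | x i ≠ y i}.Finite → ellRel W hq (θ x) (θ y)) :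
    ∃ (a : ∀ n, K n) (n l : ℕ → ℕ), StrictMono n ∧ StrictMono l ∧
      ∀ x : ∀ n, K n, (∀ i ∉ Set.range n, x i = a i) →
        ellRel W hq (θ x) (concat l fun j => θ (update a (n j) (x (n j)))) := by
  obtain ⟨a, O, h⟩ := exists_blockControl hθ (by linarith) hfin
  choose l N h using h
  exact ⟨a, N ∘ fusionStage N, l ∘ fusionStage N,
    strictMono_comp_fusionStage (fun m => (h m).le_left.trans (h m).le_right) fun _ => le_rfl,
    strictMono_comp_fusionStage (fun m => (h m).le_left) fun m => (h m).le_right,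
    fun x hx => BlockControl.ellRel_concat hq h hx⟩

end Blocks

theorem BorelReducible.exists_reducesCoordinatewise {K W : ℕ → Type*}
    [∀ n, PseudoMetricSpace (K n)] [∀ n, DiscreteTopology (K n)] [∀ n, Finite (K n)]
    [∀ n, Nonempty (K n)] [∀ n, MeasurableSpace (K n)] [∀ n, BorelSpace (K n)]
    [∀ n, PseudoMetricSpace (W n)] [∀ n, SecondCountableTopology (W n)]
    [∀ n, MeasurableSpace (W n)] [∀ n, OpensMeasurableSpace (W n)] {p q : ℝ} {hp : 1 ≤ p}
    {hq : 1 ≤ q} (h : BorelReducible (ellRel K hp) (ellRel W hq)) :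
    ∃ (z : ∀ n, W n) (n : ℕ → ℕ) (S : ∀ j, K (n j) → EllSpace W z hq),
      StrictMono n ∧ ReducesCoordinatewise S p q := by
  have hp0 : p ≠ 0 := by linarith
  obtain ⟨θ, hθ, hred⟩ := h
  obtain ⟨a, n, l, hn, hl, hθn⟩ := exists_ellRel_concat_of_measurable hθ hq fun x y hxy =>
    (hred x y).1 <| summable_of_ne_finset_zero (s := hxy.toFinset) fun i hi => by
      have : x i = y i := by simpa using hi
      simp [this, hp0]
  refine ⟨θ a, n, fun j u => .modify (θ a) hq (Finset.Ico (l j) (l (j + 1)))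
    (θ (update a (n j) u)), hn, fun x y => ?_⟩
  obtain ⟨x', hx', hxa⟩ := exists_extension_of_injective hn.injective x a
  obtain ⟨y', hy', hya⟩ := exists_extension_of_injective hn.injective y a
  have hx := hθn x' hxa
  have hy := hθn y' hya
  simp only [hx'] at hx
  simp only [hy'] at hy
  have hextend : (Summable fun j => dist (x j) (y j) ^ p) ↔ ellRel K hp x' y' := by
    simp only [← hx', ← hy']
    exact hn.injective.summable_iff (f := fun i => dist (x' i) (y' i) ^ p) fun i hi => by
      simp [hxa i hi, hya i hi, hp0]
  have hconcat : ellRel W hq (θ x') (θ y') ↔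
      ellRel W hq (concat l fun j => θ (update a (n j) (x j)))
        (concat l fun j => θ (update a (n j) (y j))) :=
    ⟨fun h => (ellRel W hq).trans ((ellRel W hq).symm hx) ((ellRel W hq).trans h hy),
      fun h => (ellRel W hq).trans hx ((ellRel W hq).trans h ((ellRel W hq).symm hy))⟩
  rw [hextend, hred, hconcat, ellRel_concat_iff hq hl]
  simp only [EllSpace.dist_modify_rpow]

theorem BorelReducible.exists_finitelyHolderEmbeds {X : Type*} [MetricSpace X] [MeasurableSpace X]
    [MeasurableSingletonClass X] {W : ℕ → Type*} [∀ n, PseudoMetricSpace (W n)]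
    [∀ n, SecondCountableTopology (W n)] [∀ n, MeasurableSpace (W n)]
    [∀ n, OpensMeasurableSpace (W n)] {p q C : ℝ} {hp : 1 ≤ p} {hq : 1 ≤ q} {F : ℕ → Set X}
    (h : BorelReducible (ellRel (fun n => F n) hp) (ellRel W hq)) (hF : IsFiniteExhaustion F)
    (hC : 0 < C) (hlink : Link X C) :
    ∃ z : ∀ n, W n, FinitelyHolderEmbeds X (EllSpace W z hq) C (p / q) := by
  have : ∀ n, Finite (F n) := hF.finite
  have : ∀ n, Nonempty (F n) := fun n => (hF.nonempty n).to_subtype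
  obtain ⟨z, n, S, hn, hS⟩ := h.exists_reducesCoordinatewise
  let S' : ℕ → X → EllSpace W z hq := fun j =>
    extend Subtype.val (S j) fun _ => .modify z hq ∅ z
  have hS' : ReducesCoordinatewise (fun j (u : F (n j)) => S' j u) p q := by
    simpa only [S', Subtype.val_injective.extend_apply] using hS
  exact ⟨z, hS'.finitelyHolderEmbeds (by linarith) (by linarith) hC (hF.comp hn) hlink⟩

theorem FinitelyHolderEmbeds.borelReducible {X Y : Type*} [PseudoMetricSpace X] [MeasurableSpace X]
    [MeasurableSingletonClass X] [PseudoMetricSpace Y] [MeasurableSpace Y] {p q C : ℝ}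
    {hq : 1 ≤ q} {Z : ℕ → Set Y} {z : ∀ n, Z n}
    (h : FinitelyHolderEmbeds X (EllSpace (fun n => Z n) z hq) C (p / q)) (hp : 1 ≤ p) (hC : 0 < C)
    {F : ℕ → Set X} (hF : ∀ n, (F n).Finite) (hZ : Monotone Z) :
    BorelReducible (ellRel (fun n => F n) hp) (ellRel (fun n => Z n) hq) := by
  have : ∀ n, Finite (F n) := hF
  obtain ⟨S, hS⟩ := h.exists_reducesCoordinatewise (by linarith) (by linarith) hC hF
  exact hS.borelReducible hp hZ

theorem mainTheorem5_general {X Y : Type*}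
    [MetricSpace X] [MeasurableSpace X] [MeasurableSingletonClass X]
    [PseudoMetricSpace Y] [TopologicalSpace.SeparableSpace Y]
    [MeasurableSpace Y] [OpensMeasurableSpace Y]
    {p q : ℝ} (hp : 1 ≤ p) (hq : 1 ≤ q)
    (Yn : ℕ → Set Y) (hYn_nonempty : (Yn 0).Nonempty) (hYn_mono : Monotone Yn)
    (hYn_dense : Dense (⋃ n, Yn n))
    {C : ℝ} (hC : 0 < C) (hlink : Link X C)
    (F : ℕ → Set X) (hF : IsFiniteExhaustion F)
    (G : ℕ → Set Y) (hG_nonempty : (G 0).Nonempty) (hG_mono : Monotone G)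
    (hG_dense : Dense (⋃ n, G n)) :
    List.TFAE [
      ∃ y : ∀ n, Yn n, FinitelyHolderEmbeds X (EllSpace (fun n => Yn n) y hq) C (p / q),
      BorelReducible (ellRel (fun n => F n) hp) (ellRel (fun n => Yn n) hq),
      BorelReducible (ellRel (fun n => F n) hp) (ellRel (fun n => G n) hq)] := by
  have := UniformSpace.secondCountable_of_separable Y
  have hα : 0 < p / q := div_pos (by linarith) (by linarith)
  obtain ⟨y, hy⟩ := hYn_nonempty
  obtain ⟨g, hg⟩ := hG_nonempty
  tfae_have 1 → 2 := fun ⟨_, h⟩ => h.borelReducible hp hC hF.finite hYn_mono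
  tfae_have 2 → 1 := fun h => h.exists_finitelyHolderEmbeds hF hC hlink
  tfae_have 1 → 3 := fun ⟨y₀, h⟩ =>
    (h.of_finitelyRepresentable_target (EllSpace.finitelyRepresentable y₀
      (fun n => ⟨g, hG_mono n.zero_le hg⟩) hq hG_mono hG_dense) hC hα).borelReducible
      hp hC hF.finite hG_mono
  tfae_have 3 → 1 := fun h => by
    obtain ⟨z, h⟩ := h.exists_finitelyHolderEmbeds hF hC hlink
    exact ⟨fun n => ⟨y, hYn_mono n.zero_le hy⟩, h.of_finitelyRepresentable_target
      (EllSpace.finitelyRepresentable z _ hq hYn_mono hYn_dense) hC hα⟩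
  tfae_finish

theorem mainTheorem5 {X Y : Type*}
    [MetricSpace X] [CompleteSpace X] [TopologicalSpace.SeparableSpace X]
    [MeasurableSpace X] [BorelSpace X]
    [MetricSpace Y] [CompleteSpace Y] [TopologicalSpace.SeparableSpace Y]
    [MeasurableSpace Y] [BorelSpace Y]
    {p q : ℝ} (hp : 1 ≤ p) (hq : 1 ≤ q)
    (Yn : ℕ → Set Y) (hYn_borel : ∀ n, MeasurableSet (Yn n)) (hYn_nonempty : (Yn 0).Nonempty)
    (hYn_mono : Monotone Yn) (hYn_dense : Dense (⋃ n, Yn n))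
    {C : ℝ} (hC : 0 < C) (hlink : Link X C)
    (F : ℕ → Set X) (hF : IsFiniteExhaustion F)
    (G : ℕ → Set Y) (hG : IsFiniteExhaustion G) :
    List.TFAE [
      ∃ y : ∀ n, Yn n, FinitelyHolderEmbeds X (EllSpace (fun n => Yn n) y hq) C (p / q),
      BorelReducible (ellRel (fun n => F n) hp) (ellRel (fun n => Yn n) hq),
      BorelReducible (ellRel (fun n => F n) hp) (ellRel (fun n => G n) hq)] :=
  mainTheorem5_general hp hq Yn hYn_nonempty hYn_mono hYn_dense hC hlink F hF G (hG.nonempty 0)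
    hG.mono hG.dense
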